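/- \textbf{Setting.} A (finite) temporal graph $G$ on a finite node set $V$ is given by a finite set $\Lambda_G$ of time edges $(e,\lambda)$, where $e=\{u,v\}$ with $u\ne v$ is an undirected edge and $\lambda\in\{1,2,\dots\}$ is a time label (an edge may carry several labels). A node $u$ reaches $v$ in $G$ if there are pairwise distinct nodes $u=v_0,\dots,v_\ell=v$ ($\ell\ge 0$) and labels $\lambda_0\le\dots\le\lambda_{\ell-1}$ with $(\{v_i,v_{i+1}\},\lambda_i)\in\Lambda_G$ for all $i<\ell$; $R_G(u)$ is the set of nodes that $u$ reaches. A host graph $H$ is a temporal graph in which every pair of distinct nodes carries at least one label and every label between $1$ and the largest one occurs, together with a set $T_H\subseteq V$ of terminals. In the global edge-buying game on $H$ every node $v$ is an agent and chooses a strategy $S_v\subseteq\Lambda_H$ (not necessarily of incident edges). A profile $\mathbf s=(S_v)_{v\in V}$ forms the temporal graph $G(\mathbf s)$ with time edges $\bigcup_v S_v$. For a fixed real constant $C>1$, the cost of $v$ is $|S_v|+C\cdot|T_H\setminus R_{G(\mathbf s)}(v)|$, and the social cost $\mathrm{SC}_H(\mathbf s)$ is the sum of the costs of all agents. A profile $\mathbf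 s$ is a Greedy Equilibrium (GE) if no agent can strictly decrease its own cost by adding a single time edge to, or removing a single time edge from, its strategy. A social optimum $\mathbf s^*_H$ is a profile of minimum social cost. For $1\le k\le n$ and $n\ge 2$, let \[ \mathsf{PoA}^{\mathsf{gl}}_{\mathsf{GE}}(n,k)=\max_{H}\ \max_{\mathbf s}\ \frac{\mathrm{SC}_H(\mathbf s)}{\mathrm{SC}_H(\mathbf s_H^*)}, \] where $H$ ranges over all host graphs with $n$ nodes and $k$ terminals and $\mathbf s$ over all GEs on $H$. \textbf{Theorem.} $\mathsf{PoA}^{\mathsf{gl}}_{\mathsf{GE}}(n,k)\in\Omega(k)$, and hence $\mathsf{PoA}^{\mathsf{gl}}_{\mathsf{GE}}(n,k)\in\Theta(k)$. Precisely: there is an absolute constant $c>0$ such that for every real $C>1$ and all integers $n\ge 2$ and $1\le k\le n$, the maximum above exists and \[ c\,k\ \le\ \mathsf{PoA}^{\mathsf{gl}}_{\mathsf{GE}}(n,k)\ \le\ k . \] -/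

import Mathlib

namespace TNCG

/-- A time edge: an undirected edge together with one time label. -/
abbrev TimeEdge (V : Type*) := Sym2 V × ℕ

/-- A (finite) temporal graph on the node set `V`, given by its set of time edges.  The edge set is
the set of `e` that carry some label, and the label set of `e` is `{l | (e, l) ∈ timeEdges}`.
There are no loops, and labels are positive integers. -/
structure TemporalGraph (V : Type*) where
  timeEdges : Finset (TimeEdge V)
  not_isDiag : ∀ e ∈ timeEdges, ¬ e.1.IsDiag
  label_pos : ∀ e ∈ timeEdges, 1 ≤ e.2

/-- A temporal path from `u` to `v`: pairwise distinct nodes `node 0, …, node length` and a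
non-decreasing (not necessarily strictly increasing) choice of labels on the traversed edges. -/
structure TemporalPath {V : Type*} (G : TemporalGraph V) (u v : V) where
  length : ℕ
  node : Fin (length + 1) → V
  label : Fin length → ℕ
  node_injective : Function.Injective node
  label_monotone : Monotone label
  mem_timeEdges : ∀ i : Fin length, (s(node i.castSucc, node i.succ), label i) ∈ G.timeEdges
  node_first : node 0 = u
  node_last : node (Fin.last length) = v

/-- `u` reaches `v` in `G`. -/
def TemporalGraph.Reaches {V : Type*} (G : TemporalGraph V) (u v : V) : Prop :=
  Nonempty (TemporalPath G u v)

/-- A temporal host graph with terminals: a complete temporal graph with a set of terminals, where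
every label between `1` and the largest one occurs. -/
structure HostGraph (V : Type*) extends TemporalGraph V where
  terminals : Finset V
  complete : ∀ e : Sym2 V, ¬ e.IsDiag → ∃ l, (e, l) ∈ timeEdges
  labels_contiguous : ∀ e ∈ timeEdges, ∀ l : ℕ, 1 ≤ l → l ≤ e.2 → ∃ e', (e', l) ∈ timeEdges

namespace HostGraph

section

variable {V : Type*} (H : HostGraph V)

/-- A strategy in the global edge-buying setting: any set of time edges of the host graph. -/
abbrev Strategy := {S : Finset (TimeEdge V) // S ⊆ H.timeEdges}

/-- A strategy profile: one strategy for every node. -/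
abbrev Profile := V → H.Strategy

end

variable {V : Type*} [Fintype V] [DecidableEq V] (H : HostGraph V)

/-- The temporal graph `G(s)` formed by the agents. -/
def formedGraph (s : H.Profile) : TemporalGraph V where
  timeEdges := Finset.univ.biUnion fun v => (s v).1
  not_isDiag := by
    intro e he
    obtain ⟨v, -, hv⟩ := Finset.mem_biUnion.1 he
    exact H.not_isDiag e ((s v).2 hv)
  label_pos := by
    intro e he
    obtain ⟨v, -, hv⟩ := Finset.mem_biUnion.1 he
    exact H.label_pos e ((s v).2 hv)

open Classical in
/-- The terminals that `v` does not reach in `G(s)`. -/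
noncomputable def unreached (s : H.Profile) (v : V) : Finset V :=
  H.terminals.filter fun t => ¬ (H.formedGraph s).Reaches v t

/-- The cost `|S_v| + C * |T \ R_{G(s)}(v)|` of agent `v`. -/
noncomputable def cost (C : ℝ) (s : H.Profile) (v : V) : ℝ :=
  ((s v).1.card : ℝ) + C * ((H.unreached s v).card : ℝ)

/-- Replacing the strategy of `v` by `S'` strictly decreases the cost of `v`. -/
def IsImprovingResponse (C : ℝ) (s : H.Profile) (v : V) (S' : H.Strategy) : Prop :=
  H.cost C (Function.update s v S') v < H.cost C s v

/-- An improving response that adds or removes a single time edge. -/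
def IsGreedyImprovingResponse (C : ℝ) (s : H.Profile) (v : V) (S' : H.Strategy) : Prop :=
  H.IsImprovingResponse C s v S' ∧ (symmDiff (s v).1 S'.1).card ≤ 1

/-- Greedy Equilibrium in the global edge-buying setting. -/
def IsGreedyEquilibrium (C : ℝ) (s : H.Profile) : Prop :=
  ∀ (v : V) (S' : H.Strategy), ¬ H.IsGreedyImprovingResponse C s v S'

/-- The social cost: the sum of the costs of all agents. -/
noncomputable def socialCost (C : ℝ) (s : H.Profile) : ℝ :=
  ∑ v, H.cost C s v

/-- A strategy profile of minimum social cost. -/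
def IsSocialOptimum (C : ℝ) (s : H.Profile) : Prop :=
  ∀ s' : H.Profile, H.socialCost C s ≤ H.socialCost C s'

end HostGraph

/-- All ratios between the social cost of a Greedy Equilibrium (in the global setting) and the
social optimum, over all host graphs with `n` nodes and `k` terminals. -/
def greedyRatios (C : ℝ) (n k : ℕ) : Set ℝ :=
  {r | ∃ H : HostGraph (Fin n), H.terminals.card = k ∧
    ∃ s : H.Profile, H.IsGreedyEquilibrium C s ∧
      ∃ o : H.Profile, H.IsSocialOptimum C o ∧ r = H.socialCost C s / H.socialCost C o}

/-- The Price of Anarchy with respect to Greedy Equilibria in the global setting. -/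
noncomputable def greedyPoA (C : ℝ) (n k : ℕ) : ℝ :=
  sSup (greedyRatios C n k)

end TNCG

/-!
An equilibrium is the same as an inclusion-minimal set of time edges in which all nodes reach all
terminals.  Indeed, because `C > 1`, an agent that does not reach a terminal gains from buying a
direct time edge to it, while no agent keeps a time edge that it does not itself need
(`HostGraph.IsGreedyEquilibrium.exists_not_reachesFrom_erase`,
`HostGraph.exists_isGreedyEquilibrium_of_minimal`).  The same deviation shows that all terminals are
reached in a social optimum, so the two social costs are numbers of time edges.

Upper bound.  For each terminal there is a spanning tree, with `n - 1` time edges, in which all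
nodes reach it: grow it from the terminal, always adding the latest possible boundary edge
(`exists_subset_card_lt_reachesFrom`).  A time edge that is needed by its owner lies in one of these
trees, so an equilibrium has at most `k * (n - 1)` time edges.  An optimum is connected and has at
least `n - 1`.  In particular, for given `n` and `k` both numbers range over finitely many values,
although there are infinitely many host graphs; hence the maximum exists.

Lower bound.  In the host graph with all labels `1, …, 2 * K + 2` on all edges a star with label `1`
is optimal.  It remains to exhibit a graph in which all nodes reach each other and many time edges
are indispensable, and to pass to a minimal subgraph.  The graph `Node.edges` consists of a path of
hubs that carries `K` labels, the lanes.  Source `i` enters this path no earlier than lane `i`, sink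
`i` is left behind by all later lanes, and detours for the other pairs of sources and sinks are
arranged so as not to help this pair.  Source `i` thus needs all of lane `i`, which is certified by
an explicit lower bound on arrival times (`Node.not_reachesFrom_edges_diff`).  With `K = k / 6` lanes
and at least half of the nodes on the path, this gives `K * m` time edges, at least
`k * (n - 1) / 36`.  For small `k` the bound follows from the ratio being at least `1`.
-/

namespace TNCG

/-! ### Temporal reachability with a departure time -/

/-- `v` reaches `t` by a temporal walk in `E` all of whose labels are at least `τ`.  Walks may
repeat nodes; `reaches_iff_reachesFrom` shows that this makes no difference. -/
inductive ReachesFrom {V : Type*} (E : Set (TimeEdge V)) (t : V) : V → ℕ → Prop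
  | refl (τ : ℕ) : ReachesFrom E t t τ
  | step {v x : V} {τ l : ℕ} (he : (s(v, x), l) ∈ E) (hl : τ ≤ l) (h : ReachesFrom E t x l) :
      ReachesFrom E t v τ

section Reachability

variable {V : Type*} {E F : Set (TimeEdge V)} {t u v : V}

theorem ReachesFrom.antitone {τ σ : ℕ} (h : ReachesFrom E t v τ) (hσ : σ ≤ τ) :
    ReachesFrom E t v σ := by
  cases h with
  | refl => exact .refl _
  | step he hl h => exact .step he (hσ.trans hl) h

theorem ReachesFrom.mono {τ : ℕ} (h : ReachesFrom E t v τ) (hEF : E ⊆ F) :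
    ReachesFrom F t v τ := by
  induction h with
  | refl => exact .refl _
  | step he hl _ ih => exact .step (hEF he) hl ih

/-- A temporal walk contains a temporal path.  The path is given by sequences on all of `ℕ`, of
which only the first `n + 1` nodes and the first `n` labels matter: this makes passing to a suffix
a mere shift of indices. -/
theorem ReachesFrom.exists_path {τ : ℕ} (h : ReachesFrom E t v τ) :
    ∃ (n : ℕ) (p : ℕ → V) (l : ℕ → ℕ), p 0 = v ∧ p n = t ∧
      (∀ i ≤ n, ∀ j ≤ n, p i = p j → i = j) ∧
      (∀ i < n, (s(p i, p (i + 1)), l i) ∈ E) ∧ (∀ i < n, τ ≤ l i) ∧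
      (∀ i j, i ≤ j → j < n → l i ≤ l j) := by
  induction h with
  | refl τ => exact ⟨0, fun _ => t, fun _ => 0, rfl, rfl, by omega, by omega, by omega, by omega⟩
  | @step v x τ l he hl _ ih =>
    obtain ⟨n, p, q, h0, hn, hinj, hE, hτ, hmono⟩ := ih
    by_cases hv : ∃ i ≤ n, p i = v
    · -- The walk returns to `v`: only the part after the return is kept.
      obtain ⟨i, hi, rfl⟩ := hv
      refine ⟨n - i, fun j => p (j + i), fun j => q (j + i), by simp, by
        simp [Nat.sub_add_cancel hi, hn], ?_, ?_, ?_, ?_⟩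
      · intro a ha b hb hab
        have := hinj _ (by omega) _ (by omega) hab
        omega
      · intro a ha
        have := hE (a + i) (by omega)
        rwa [show a + i + 1 = a + 1 + i by omega] at this
      · exact fun a ha => hl.trans (hτ _ (by omega))
      · exact fun a b hab hb => hmono _ _ (by omega) (by omega)
    · push Not at hv
      refine ⟨n + 1, fun j => Nat.casesOn j v p, fun j => Nat.casesOn j l q, rfl, hn,
        ?_, ?_, ?_, ?_⟩
      · rintro (_ | a) ha (_ | b) hb hab
        · rfl
        · exact absurd hab.symm (hv b (by omega))
        · exact absurd hab (hv a (by omega))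
        · rw [hinj a (by omega) b (by omega) hab]
      · rintro (_ | a) ha
        · simpa [h0] using he
        · exact hE a (by omega)
      · rintro (_ | a) ha
        · exact hl
        · exact hl.trans (hτ a (by omega))
      · rintro (_ | a) (_ | b) hab hb
        · exact le_rfl
        · exact hτ b (by omega)
        · omega
        · exact hmono a b (by omega) (by omega)

theorem reaches_iff_reachesFrom {G : TemporalGraph V} :
    G.Reaches u v ↔ ReachesFrom (G.timeEdges : Set (TimeEdge V)) v u 0 := by
  constructor
  · rintro ⟨P⟩
    have key : ∀ i : Fin (P.length + 1), ∀ τ,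
        (∀ j : Fin P.length, i ≤ j.castSucc → τ ≤ P.label j) →
          ReachesFrom (G.timeEdges : Set (TimeEdge V)) v (P.node i) τ := by
      intro i
      induction i using Fin.reverseInduction with
      | last => intro τ _; rw [P.node_last]; exact .refl _
      | cast i ih =>
        intro τ hτ
        refine .step (P.mem_timeEdges i) (hτ i le_rfl) (ih _ fun j hj => P.label_monotone ?_)
        exact (Fin.castSucc_lt_castSucc_iff.1 (Fin.castSucc_lt_succ.trans_le hj)).le
    simpa [P.node_first] using key 0 0 (by simp)
  · intro h
    obtain ⟨n, p, l, h0, hn, hinj, hE, -, hmono⟩ := h.exists_path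
    exact ⟨{
      length := n
      node := fun i => p i
      label := fun i => l i
      node_injective := fun i j hij =>
        Fin.ext (hinj _ (by omega) _ (by omega) hij)
      label_monotone := fun i j hij => hmono _ _ hij j.2
      mem_timeEdges := fun i => by simpa using hE i i.2
      node_first := by simpa using h0
      node_last := by simpa using hn }⟩

/-- Lower bounds `S` on arrival times that are consistent along every time edge of `E` show that
nodes whose bound exceeds all labels are not reached. -/
theorem not_reachesFrom_of_arrival_bound {L : ℕ} (S : V → ℕ)
    (hL : ∀ e ∈ E, e.2 ≤ L)
    (hS : ∀ x y l, (s(x, y), l) ∈ E → S x ≤ l → S y ≤ l) (hv : S v = 0) (ht : L < S t) :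
    ¬ ReachesFrom E t v 0 := by
  have key : ∀ x τ, ReachesFrom E t x τ → τ ≤ L → S x ≤ τ → False := by
    intro x τ h
    induction h with
    | refl τ => intro h₁ h₂; omega
    | step he hl _ ih => exact fun h₁ h₂ => ih (hL _ he) (hS _ _ _ he (h₂.trans hl))
  exact fun h => key _ _ h (Nat.zero_le _) hv.le

/-- A walk into a set `A` containing its end crosses the boundary of `A`, not before it departs. -/
theorem ReachesFrom.exists_boundary {τ : ℕ} (h : ReachesFrom E t v τ) {A : Set V} (ht : t ∈ A)
    (hv : v ∉ A) :
    ∃ x ∉ A, ∃ y ∈ A, ∃ l, (s(x, y), l) ∈ E ∧ τ ≤ l ∧ ReachesFrom E t y l := by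
  induction h with
  | refl => exact absurd ht hv
  | @step v x τ l he hl h ih =>
    by_cases hx : x ∈ A
    · exact ⟨v, hv, x, hx, l, he, hl, h⟩
    · obtain ⟨x', hx', y, hy, l', he', hl', h'⟩ := ih hx
      exact ⟨x', hx', y, hy, l', he', hl.trans hl', h'⟩

end Reachability

section Counting

variable {V : Type*} [Fintype V] [DecidableEq V] {E : Finset (TimeEdge V)} {t : V}

/-- If all nodes reach `t`, then they already do so in a spanning tree.  The tree is grown from `t`
by always adding a boundary edge with the largest label that still allows to reach `t`; in this
way every node of the tree departs as late within the tree as it can within `E`. -/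
theorem exists_subset_card_lt_reachesFrom
    (h : ∀ v, ReachesFrom (E : Set (TimeEdge V)) t v 0) :
    ∃ F ⊆ E, F.card < Fintype.card V ∧ ∀ v, ReachesFrom (F : Set (TimeEdge V)) t v 0 := by
  have grow : ∀ d < Fintype.card V, ∃ (A : Finset V) (F : Finset (TimeEdge V)),
      A.card = d + 1 ∧ F ⊆ E ∧ F.card ≤ d ∧ t ∈ A ∧ ∀ v ∈ A, ∀ τ,
        ReachesFrom (E : Set (TimeEdge V)) t v τ → ReachesFrom (F : Set (TimeEdge V)) t v τ := by
    intro d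
    induction d with
    | zero =>
      intro _
      refine ⟨{t}, ∅, by simp, by simp, by simp, by simp, ?_⟩
      intro v hv τ _
      rw [Finset.mem_singleton.1 hv]
      exact .refl _
    | succ d ih =>
      intro hd
      obtain ⟨A, F, hA, hFE, hF, htA, hAF⟩ := ih (by omega)
      obtain ⟨v, hv⟩ : ∃ v, v ∉ A := by
        by_contra hall
        push Not at hall
        rw [Finset.eq_univ_of_forall hall, Finset.card_univ] at hA
        omega
      classical
      let B := E.filter fun e => ∃ x ∉ A, ∃ y ∈ A, e.1 = s(x, y) ∧
        ReachesFrom (E : Set (TimeEdge V)) t y e.2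
      have crossing : ∀ v ∉ A, ∀ τ, ReachesFrom (E : Set (TimeEdge V)) t v τ →
          ∃ e ∈ B, τ ≤ e.2 := by
        intro v hv τ hτ
        obtain ⟨x, hx, y, hy, l, he, hl, hyl⟩ :=
          hτ.exists_boundary (A := (A : Set V)) (by simpa using htA) (by simpa using hv)
        exact ⟨(s(x, y), l), Finset.mem_filter.2
          ⟨by simpa using he, x, by simpa using hx, y, by simpa using hy, rfl, hyl⟩, hl⟩
      have hB : B.Nonempty := by
        obtain ⟨e, he, -⟩ := crossing v hv 0 (h v)
        exact ⟨e, he⟩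
      obtain ⟨⟨e, l⟩, heB, hmax⟩ := B.exists_max_image (fun e => e.2) hB
      obtain ⟨heE, x, hx, y, hy, rfl, hyl⟩ := Finset.mem_filter.1 heB
      have hsub : (F : Set (TimeEdge V)) ⊆ (insert (s(x, y), l) F : Finset (TimeEdge V)) := by
        simp
      refine ⟨insert x A, insert (s(x, y), l) F, by rw [Finset.card_insert_of_notMem hx, hA],
        Finset.insert_subset heE hFE, (Finset.card_insert_le _ _).trans (by omega), by simp [htA],
        ?_⟩
      intro z hz τ hτ
      rcases Finset.mem_insert.1 hz with rfl | hz
      · obtain ⟨e', he', hle⟩ := crossing z hx τ hτ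
        exact .step (by simp) (hle.trans (hmax e' he')) ((hAF y hy _ hyl).mono hsub)
      · exact (hAF z hz τ hτ).mono hsub
  have hpos : 0 < Fintype.card V := Fintype.card_pos_iff.2 ⟨t⟩
  obtain ⟨A, F, hA, hFE, hF, -, hAF⟩ := grow (Fintype.card V - 1) (by omega)
  have hu : A = Finset.univ := (Finset.card_eq_iff_eq_univ _).1 (by omega)
  exact ⟨F, hFE, by omega, fun v => hAF v (by simp [hu]) 0 (h v)⟩

/-- The underlying graph of `E` is connected if all nodes reach `t`. -/
theorem card_le_card_add_one_of_reachesFrom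
    (h : ∀ v, ReachesFrom (E : Set (TimeEdge V)) t v 0) : Fintype.card V ≤ E.card + 1 := by
  let G : SimpleGraph V := SimpleGraph.fromEdgeSet (E.image Prod.fst : Finset (Sym2 V))
  have hG : ∀ v τ, ReachesFrom (E : Set (TimeEdge V)) t v τ → G.Reachable v t := by
    intro v τ hv
    induction hv with
    | refl => exact .refl _
    | @step v x τ l he _ _ ih =>
      by_cases hvx : v = x
      · rwa [hvx]
      · refine SimpleGraph.Reachable.trans (SimpleGraph.Adj.reachable ?_) ih
        rw [SimpleGraph.fromEdgeSet_adj]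
        exact ⟨by simpa using ⟨l, by simpa using he⟩, hvx⟩
  have hconn : G.Connected :=
    { preconnected := fun u v => (hG u 0 (h u)).trans (hG v 0 (h v)).symm
      nonempty := ⟨t⟩ }
  have h₁ := hconn.card_vert_le_card_edgeSet_add_one
  have h₂ : Nat.card G.edgeSet ≤ E.card := by
    have hsub : G.edgeSet ⊆ (E.image Prod.fst : Finset (Sym2 V)) := by
      rw [SimpleGraph.edgeSet_fromEdgeSet]
      exact Set.sdiff_subset
    calc Nat.card G.edgeSet ≤ Nat.card ((E.image Prod.fst : Finset (Sym2 V)) : Set (Sym2 V)) :=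
          Nat.card_mono (Finset.finite_toSet _) hsub
      _ = (E.image Prod.fst).card := by simp
      _ ≤ E.card := Finset.card_image_le
  rw [Nat.card_eq_fintype_card] at h₁
  omega

end Counting

/-! ### Equilibria and optima of the game -/

/-- In `E` every node reaches every node of `T`. -/
def ReachesAll {V : Type*} (T : Finset V) (E : Set (TimeEdge V)) : Prop :=
  ∀ v, ∀ t ∈ T, ReachesFrom E t v 0

namespace HostGraph

theorem reachesAll_timeEdges {V : Type*} (H : HostGraph V) (T : Finset V) :
    ReachesAll T (H.timeEdges : Set (TimeEdge V)) := by
  intro v t _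
  by_cases hvt : v = t
  · rw [hvt]; exact .refl _
  · obtain ⟨l, hl⟩ := H.complete s(v, t) (by simpa using hvt)
    exact .step (by exact_mod_cast hl) (Nat.zero_le _) (.refl _)

variable {V : Type*} [Fintype V] [DecidableEq V] (H : HostGraph V) {C : ℝ}

instance : Finite H.Strategy :=
  Finite.of_injective (β := H.timeEdges.powerset) (fun S => ⟨S.1, Finset.mem_powerset.2 S.2⟩)
    fun _ _ h => Subtype.ext (congrArg (fun x => x.1) h)

theorem mem_formedGraph {s : H.Profile} {e : TimeEdge V} :
    e ∈ (H.formedGraph s).timeEdges ↔ ∃ v, e ∈ (s v).1 := by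
  simp [formedGraph]

theorem mem_unreached {s : H.Profile} {v t : V} :
    t ∈ H.unreached s v ↔ t ∈ H.terminals ∧
      ¬ ReachesFrom ((H.formedGraph s).timeEdges : Set (TimeEdge V)) t v 0 := by
  simp [unreached, reaches_iff_reachesFrom]

theorem unreached_eq_empty_iff {s : H.Profile} :
    (∀ v, H.unreached s v = ∅) ↔ ReachesAll H.terminals (H.formedGraph s).timeEdges := by
  simp only [Finset.eq_empty_iff_forall_notMem, mem_unreached, ReachesAll, not_and, not_not]

theorem socialCost_of_reachesAll {s : H.Profile}
    (h : ReachesAll H.terminals ((H.formedGraph s).timeEdges : Set (TimeEdge V))) :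
    H.socialCost C s = ((∑ v, (s v).1.card : ℕ) : ℝ) := by
  simp [socialCost, cost, H.unreached_eq_empty_iff.2 h]

theorem formedGraph_subset_update {s : H.Profile} {v : V} {S : H.Strategy}
    (h : (s v).1 ⊆ S.1) :
    (H.formedGraph s).timeEdges ⊆ (H.formedGraph (Function.update s v S)).timeEdges := by
  intro e he
  obtain ⟨w, hw⟩ := H.mem_formedGraph.1 he
  refine H.mem_formedGraph.2 ⟨w, ?_⟩
  by_cases hwv : w = v
  · subst hwv; simpa using h hw
  · simpa [hwv] using hw

theorem unreached_anti {s s' : H.Profile}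
    (h : (H.formedGraph s).timeEdges ⊆ (H.formedGraph s').timeEdges) (v : V) :
    H.unreached s' v ⊆ H.unreached s v := by
  intro t ht
  rw [mem_unreached] at ht ⊢
  exact ⟨ht.1, fun hr => ht.2 (hr.mono (by exact_mod_cast h))⟩

/-- An agent that does not reach a terminal can buy one time edge to it.  This lowers its own cost,
as `C > 1`, and harms nobody. -/
theorem exists_insert_of_mem_unreached (hC : 1 < C) {s : H.Profile} {v t : V}
    (ht : t ∈ H.unreached s v) :
    ∃ S : H.Strategy, (symmDiff (s v).1 S.1).card ≤ 1 ∧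
      H.cost C (Function.update s v S) v < H.cost C s v ∧
      ∀ w ≠ v, H.cost C (Function.update s v S) w ≤ H.cost C s w := by
  have ht' := H.mem_unreached.1 ht
  have hvt : v ≠ t := by
    rintro rfl
    exact ht'.2 (.refl _)
  obtain ⟨l, hl⟩ := H.complete s(v, t) (by simpa using hvt)
  refine ⟨⟨insert (s(v, t), l) (s v).1, Finset.insert_subset hl (s v).2⟩, ?_, ?_, ?_⟩
  · refine (Finset.card_le_card ?_).trans (Finset.card_singleton (s(v, t), l)).le
    intro e he
    simp only [Finset.mem_symmDiff, Finset.mem_insert] at he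
    simp only [Finset.mem_singleton]
    tauto
  · set S : H.Strategy := ⟨insert (s(v, t), l) (s v).1, Finset.insert_subset hl (s v).2⟩ with hS
    have hsub : H.unreached (Function.update s v S) v ⊂ H.unreached s v := by
      refine Finset.ssubset_iff_subset_ne.2
        ⟨H.unreached_anti (H.formedGraph_subset_update (by simp [hS])) v, fun heq => ?_⟩
      rw [← heq, mem_unreached] at ht
      refine ht.2 (.step (x := t) (l := l) ?_ (Nat.zero_le _) (.refl _))
      have : (s(v, t), l) ∈ (H.formedGraph (Function.update s v S)).timeEdges :=
        H.mem_formedGraph.2 ⟨v, by simp [hS]⟩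
      exact_mod_cast this
    have h₁ : ((H.unreached (Function.update s v S) v).card : ℝ) + 1 ≤ (H.unreached s v).card := by
      exact_mod_cast Finset.card_lt_card hsub
    have h₂ : (S.1.card : ℝ) ≤ (s v).1.card + 1 := by
      exact_mod_cast Finset.card_insert_le _ _
    simp only [cost, Function.update_self]
    nlinarith
  · intro w hw
    have h₁ := Finset.card_le_card (H.unreached_anti (H.formedGraph_subset_update
      (s := s) (v := v) (S := ⟨insert (s(v, t), l) (s v).1, Finset.insert_subset hl (s v).2⟩)
      (by simp)) w)
    simp only [cost, Function.update_of_ne hw]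
    gcongr

variable {H}

theorem IsGreedyEquilibrium.reachesAll (hC : 1 < C) {s : H.Profile}
    (hs : H.IsGreedyEquilibrium C s) :
    ReachesAll H.terminals ((H.formedGraph s).timeEdges : Set (TimeEdge V)) := by
  rw [← unreached_eq_empty_iff]
  intro v
  by_contra hne
  obtain ⟨t, ht⟩ := Finset.nonempty_iff_ne_empty.2 hne
  obtain ⟨S, hS, hlt, -⟩ := H.exists_insert_of_mem_unreached hC ht
  exact hs v S ⟨hlt, hS⟩

theorem IsSocialOptimum.reachesAll (hC : 1 < C) {o : H.Profile} (ho : H.IsSocialOptimum C o) :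
    ReachesAll H.terminals ((H.formedGraph o).timeEdges : Set (TimeEdge V)) := by
  rw [← unreached_eq_empty_iff]
  intro v
  by_contra hne
  obtain ⟨t, ht⟩ := Finset.nonempty_iff_ne_empty.2 hne
  obtain ⟨S, -, hlt, hle⟩ := H.exists_insert_of_mem_unreached hC ht
  refine (ho (Function.update o v S)).not_gt (Finset.sum_lt_sum (fun w _ => ?_) ⟨v, by simp, hlt⟩)
  by_cases hw : w = v
  · rw [hw]; exact hlt.le
  · exact hle w hw

/-- In an equilibrium the owner of a time edge needs it to reach some terminal; otherwise selling it
would save cost `1`. -/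
theorem IsGreedyEquilibrium.exists_not_reachesFrom_erase (hC : 1 < C) {s : H.Profile}
    (hs : H.IsGreedyEquilibrium C s) {v : V} {e : TimeEdge V} (he : e ∈ (s v).1) :
    ∃ t ∈ H.terminals, ¬ ReachesFrom
      ((H.formedGraph (Function.update s v
        ⟨(s v).1.erase e, (Finset.erase_subset _ _).trans (s v).2⟩)).timeEdges :
          Set (TimeEdge V)) t v 0 := by
  set S : H.Strategy := ⟨(s v).1.erase e, (Finset.erase_subset _ _).trans (s v).2⟩ with hS
  by_contra! hall
  refine hs v S ⟨?_, ?_⟩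
  · have h₁ : H.unreached (Function.update s v S) v = ∅ := by
      rw [Finset.eq_empty_iff_forall_notMem]
      intro t ht
      rw [mem_unreached] at ht
      exact ht.2 (hall t ht.1)
    have h₂ : H.unreached s v = ∅ := H.unreached_eq_empty_iff.2 (hs.reachesAll hC) v
    have h₃ : (S.1.card : ℝ) < (s v).1.card := by
      exact_mod_cast Finset.card_erase_lt_of_mem he
    simpa [IsImprovingResponse, cost, h₁, h₂] using h₃
  · refine (Finset.card_le_card ?_).trans (Finset.card_singleton e).le
    intro e' he'
    simp only [Finset.mem_symmDiff, hS, Finset.mem_erase] at he'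
    simp only [Finset.mem_singleton]
    tauto

/-- For every terminal fix a spanning tree in which all nodes reach it.  Every time edge is needed
by its owner and hence lies in one of these trees. -/
theorem IsGreedyEquilibrium.sum_card_le (hC : 1 < C) {s : H.Profile}
    (hs : H.IsGreedyEquilibrium C s) :
    ∑ v, (s v).1.card ≤ H.terminals.card * (Fintype.card V - 1) := by
  have hreach := hs.reachesAll hC
  have htree : ∀ t, ∃ F ⊆ (H.formedGraph s).timeEdges, t ∈ H.terminals →
      F.card ≤ Fintype.card V - 1 ∧ ∀ v, ReachesFrom (F : Set (TimeEdge V)) t v 0 := by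
    intro t
    by_cases ht : t ∈ H.terminals
    · obtain ⟨F, hF, hc, hr⟩ := exists_subset_card_lt_reachesFrom fun v => hreach v t ht
      exact ⟨F, hF, fun _ => ⟨by omega, hr⟩⟩
    · exact ⟨∅, by simp, fun h => absurd h ht⟩
  choose F hF hFt using htree
  have hdisj : (Set.univ : Set V).PairwiseDisjoint fun v => (s v).1 := by
    intro v _ w _ hvw
    refine Finset.disjoint_left.2 fun e hev hew => ?_
    obtain ⟨t, ht, hr⟩ := hs.exists_not_reachesFrom_erase hC hev
    refine hr ((hreach v t ht).mono ?_)
    intro e' he'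
    rw [Finset.mem_coe, mem_formedGraph] at he' ⊢
    obtain ⟨u, hu⟩ := he'
    by_cases hee : e' = e
    · exact ⟨w, by simpa [hvw.symm, hee] using hew⟩
    · refine ⟨u, ?_⟩
      by_cases huv : u = v
      · subst huv; simpa [hee] using hu
      · simpa [huv] using hu
  calc ∑ v, (s v).1.card = (Finset.univ.biUnion fun v => (s v).1).card :=
        (Finset.card_biUnion fun v _ w _ h => hdisj (Set.mem_univ v) (Set.mem_univ w) h).symm
    _ ≤ (H.terminals.biUnion F).card := by
        refine Finset.card_le_card fun e he => ?_
        obtain ⟨v, -, hev⟩ := Finset.mem_biUnion.1 he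
        obtain ⟨t, ht, hr⟩ := hs.exists_not_reachesFrom_erase hC hev
        refine Finset.mem_biUnion.2 ⟨t, ht, ?_⟩
        by_contra heF
        refine hr (((hFt t ht).2 v).mono ?_)
        intro e' he'
        rw [Finset.mem_coe] at he' ⊢
        obtain ⟨u, hu⟩ := H.mem_formedGraph.1 (hF t he')
        have hee : e' ≠ e := by
          rintro rfl
          exact heF he'
        rw [mem_formedGraph]
        refine ⟨u, ?_⟩
        by_cases huv : u = v
        · subst huv; simpa [hee] using hu
        · simpa [huv] using hu
    _ ≤ ∑ t ∈ H.terminals, (F t).card := Finset.card_biUnion_le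
    _ ≤ H.terminals.card * (Fintype.card V - 1) :=
        Finset.sum_le_card_nsmul _ _ _ fun t ht => (hFt t ht).1

theorem card_le_sum_card_add_one {s : H.Profile} (hT : H.terminals.Nonempty)
    (h : ReachesAll H.terminals ((H.formedGraph s).timeEdges : Set (TimeEdge V))) :
    Fintype.card V ≤ ∑ v, (s v).1.card + 1 := by
  obtain ⟨t, ht⟩ := hT
  have h₁ := card_le_card_add_one_of_reachesFrom fun v => h v t ht
  have h₂ : (H.formedGraph s).timeEdges.card ≤ ∑ v, (s v).1.card := Finset.card_biUnion_le
  omega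

/-- An inclusion-minimal set of time edges in which all terminals are reached is formed by an
equilibrium: each time edge is bought by a node that needs it. -/
theorem exists_isGreedyEquilibrium_of_minimal (hC : 1 < C) {E : Finset (TimeEdge V)}
    (hE : E ⊆ H.timeEdges)
    (hmin : Minimal (fun E : Finset (TimeEdge V) => ReachesAll H.terminals (E : Set _)) E) :
    ∃ s : H.Profile, H.IsGreedyEquilibrium C s ∧ H.socialCost C s = E.card := by
  have howner : ∀ e, ∃ v, e ∈ E → ∃ t ∈ H.terminals,
      ¬ ReachesFrom (E.erase e : Set (TimeEdge V)) t v 0 := by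
    intro e
    by_cases he : e ∈ E
    · have := hmin.not_prop_of_lt (Finset.erase_ssubset he)
      simp only [ReachesAll, not_forall] at this
      obtain ⟨v, t, ht, hr⟩ := this
      exact ⟨v, fun _ => ⟨t, ht, by simpa using hr⟩⟩
    · induction e.1 with
      | h x y => exact ⟨x, fun h => absurd h he⟩
  choose owner howner using howner
  let s : H.Profile := fun v =>
    ⟨E.filter fun e => owner e = v, (Finset.filter_subset _ _).trans hE⟩
  have hs : ∀ v, (s v).1 = E.filter fun e => owner e = v := fun _ => rfl
  have hformed : (H.formedGraph s).timeEdges = E := by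
    ext e
    simp [mem_formedGraph, hs]
  have hreach : ReachesAll H.terminals ((H.formedGraph s).timeEdges : Set (TimeEdge V)) := by
    rw [hformed]; exact hmin.prop
  refine ⟨s, ?_, ?_⟩
  · rintro v S ⟨himp, hcard⟩
    have h₀ : H.unreached s v = ∅ := H.unreached_eq_empty_iff.2 hreach v
    simp only [IsImprovingResponse, cost, Function.update_self, h₀, Finset.card_empty,
      Nat.cast_zero, mul_zero, add_zero] at himp
    set U := H.unreached (Function.update s v S) v with hU
    have hlt : S.1.card < (s v).1.card := by
      have : (S.1.card : ℝ) < (s v).1.card := by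
        have : 0 ≤ C * (U.card : ℝ) := by positivity
        linarith
      exact_mod_cast this
    -- A cheaper strategy that differs in at most one time edge arises by selling one.
    obtain ⟨e, he, heS⟩ : ∃ e ∈ (s v).1, e ∉ S.1 := by
      by_contra! hall
      exact hlt.not_ge (Finset.card_le_card hall)
    have hS : (s v).1.erase e ⊆ S.1 := by
      intro e' he'
      rw [Finset.mem_erase] at he'
      by_contra he'S
      exact he'.1 (Finset.card_le_one.1 hcard e' (Finset.mem_symmDiff.2 (.inl ⟨he'.2, he'S⟩)) e
        (Finset.mem_symmDiff.2 (.inl ⟨he, heS⟩)))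
    have hSle : S.1 ⊆ (s v).1 := by
      intro e' he'
      by_contra he's
      have := Finset.card_le_one.1 hcard e' (Finset.mem_symmDiff.2 (.inr ⟨he', he's⟩)) e
        (Finset.mem_symmDiff.2 (.inl ⟨he, heS⟩))
      exact heS (this ▸ he')
    have hcardS : ((s v).1.card : ℝ) ≤ S.1.card + 1 := by
      have h₁ := Finset.card_le_card hS
      rw [Finset.card_erase_of_mem he] at h₁
      exact_mod_cast (by omega : (s v).1.card ≤ S.1.card + 1)
    have heE := Finset.mem_filter.1 (hs v ▸ he)
    obtain ⟨t, ht, hr⟩ := howner e heE.1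
    rw [heE.2] at hr
    have htU : t ∈ U := by
      rw [hU, mem_unreached]
      refine ⟨ht, fun h => hr (h.mono ?_)⟩
      intro e' he'
      rw [Finset.mem_coe, mem_formedGraph] at he'
      obtain ⟨u, hu⟩ := he'
      by_cases huv : u = v
      · subst huv
        rw [Function.update_self] at hu
        refine Finset.mem_coe.2 (Finset.mem_erase.2 ⟨?_, (Finset.mem_filter.1 (hs u ▸ hSle hu)).1⟩)
        rintro rfl
        exact heS hu
      · rw [Function.update_of_ne huv] at hu
        have hu' := Finset.mem_filter.1 (hs u ▸ hu)
        refine Finset.mem_coe.2 (Finset.mem_erase.2 ⟨?_, hu'.1⟩)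
        rintro rfl
        exact huv (hu'.2.symm.trans heE.2)
    have hUpos : (1 : ℝ) ≤ U.card := by
      exact_mod_cast Finset.card_pos.2 ⟨t, htU⟩
    nlinarith
  · rw [H.socialCost_of_reachesAll hreach]
    have := Finset.card_eq_sum_card_fiberwise (f := owner) (s := E) (t := Finset.univ) (by simp)
    exact_mod_cast this.symm

/-- Every set of time edges in which all terminals are reached contains an equilibrium, and this
keeps the time edges without which some terminal is not reached. -/
theorem exists_isGreedyEquilibrium_card_le (hC : 1 < C) {E D : Finset (TimeEdge V)}
    (hE : E ⊆ H.timeEdges) (hreach : ReachesAll H.terminals (E : Set (TimeEdge V)))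
    (hD : ∀ e ∈ D, ¬ ReachesAll H.terminals ((E : Set (TimeEdge V)) \ {e})) :
    ∃ s : H.Profile, H.IsGreedyEquilibrium C s ∧ (D.card : ℝ) ≤ H.socialCost C s := by
  obtain ⟨M, hME, hM⟩ := exists_minimal_le_of_wellFoundedLT
    (fun E : Finset (TimeEdge V) => ReachesAll H.terminals (E : Set _)) E hreach
  obtain ⟨s, hs, hcost⟩ := exists_isGreedyEquilibrium_of_minimal hC (hME.trans hE) hM
  refine ⟨s, hs, ?_⟩
  rw [hcost]
  refine Nat.cast_le.2 (Finset.card_le_card fun e he => ?_)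
  by_contra heM
  refine hD e he fun v t ht => (hM.prop v t ht).mono fun e' he' => ⟨hME he', ?_⟩
  rintro rfl
  exact heM he'

theorem exists_isSocialOptimum (H : HostGraph V) (C : ℝ) : ∃ o : H.Profile,
    H.IsSocialOptimum C o := by
  have : Nonempty H.Profile := ⟨fun _ => ⟨∅, by simp⟩⟩
  exact Finite.exists_min (H.socialCost C)

end HostGraph

/-! ### A dense graph in which the terminals are reached -/

/-- The nodes of the dense graph: `K` sources, relays and sinks, and a path of `m + 1` hubs. -/
inductive Node (K m : ℕ)
  | source (i : Fin K)
  | relay (i : Fin K)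
  | sink (i : Fin K)
  | hub (q : Fin (m + 1))

namespace Node

variable {K m : ℕ}

def equivSum : Node K m ≃ (Fin K ⊕ Fin K) ⊕ (Fin K ⊕ Fin (m + 1)) where
  toFun
    | source i => .inl (.inl i)
    | relay i => .inl (.inr i)
    | sink i => .inr (.inl i)
    | hub q => .inr (.inr q)
  invFun
    | .inl (.inl i) => source i
    | .inl (.inr i) => relay i
    | .inr (.inl i) => sink i
    | .inr (.inr q) => hub q
  left_inv x := by cases x <;> rfl
  right_inv x := by rcases x with (_ | _) | (_ | _) <;> rfl

/-- The time edges of the dense graph, with a fixed orientation.  With label `K + 1 + i` the path of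
hubs is joined to source `i` at its first hub and to sink `i` at its last one, forming lane `i`.
Source `i` catches the lanes `i, i + 1, …` only.  It reaches the sinks of the earlier lanes through
their relays, which are reached before all lanes and left after all lanes; the labels `1 + (j - l)`
exclude that source `i` reaches a source `j < i` or relay `i` in this way.  The labels `1` and
`2 * K + 2` let the remaining pairs of nodes reach each other. -/
inductive Arc : Node K m → Node K m → ℕ → Prop
  | lane (i : Fin K) (q : Fin m) : Arc (hub q.castSucc) (hub q.succ) (K + 1 + i)
  | enter (i : Fin K) : Arc (source i) (hub 0) (K + 1 + i)
  | leave (i : Fin K) : Arc (sink i) (hub (Fin.last m)) (K + 1 + i)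
  | toRelay (j l : Fin K) (h : l < j) : Arc (source j) (relay l) (1 + (j - l))
  | fromRelay (l : Fin K) : Arc (relay l) (sink l) (2 * K + 1)
  | startRelay (l : Fin K) : Arc (relay l) (hub 0) 1
  | startSink (l : Fin K) : Arc (sink l) (hub 0) 1
  | endSource (j : Fin K) : Arc (source j) (hub 0) (2 * K + 2)
  | endRelay (l : Fin K) : Arc (relay l) (hub 0) (2 * K + 2)

/-- The time edges of the dense graph. -/
def edges (K m : ℕ) : Set (TimeEdge (Node K m)) :=
  {e | ∃ x y, Arc x y e.2 ∧ e.1 = s(x, y)}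

theorem Arc.mem_edges {x y : Node K m} {l : ℕ} (h : Arc x y l) : (s(x, y), l) ∈ edges K m :=
  ⟨x, y, h, rfl⟩

theorem Arc.mem_edges' {x y : Node K m} {l : ℕ} (h : Arc x y l) : (s(y, x), l) ∈ edges K m :=
  ⟨x, y, h, Sym2.eq_swap⟩

theorem label_mem_of_mem_edges {e : TimeEdge (Node K m)} (he : e ∈ edges K m) :
    e.2 ∈ Finset.Icc 1 (2 * K + 2) := by
  obtain ⟨x, y, h, -⟩ := he
  rw [Finset.mem_Icc]
  generalize e.2 = l at h
  cases h <;> omega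

theorem not_isDiag_of_mem_edges {e : TimeEdge (Node K m)} (he : e ∈ edges K m) :
    ¬ e.1.IsDiag := by
  obtain ⟨x, y, h, he⟩ := he
  rw [he, Sym2.mk_isDiag_iff]
  generalize e.2 = l at h
  cases h <;> simp [Fin.ext_iff]

/-- All hubs reach each other within a lane. -/
theorem reachesFrom_of_hub {y : Node K m} {i : Fin K} {q' : Fin (m + 1)}
    (h : ReachesFrom (edges K m) y (hub q') (K + 1 + i)) (q : Fin (m + 1)) :
    ReachesFrom (edges K m) y (hub q) (K + 1 + i) := by
  have hstep : ∀ p : Fin m, ReachesFrom (edges K m) y (hub p.castSucc) (K + 1 + i) ↔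
      ReachesFrom (edges K m) y (hub p.succ) (K + 1 + i) := fun p =>
    ⟨.step (Arc.lane i p).mem_edges' le_rfl, .step (Arc.lane i p).mem_edges le_rfl⟩
  have h0 : ∀ q : Fin (m + 1), ReachesFrom (edges K m) y (hub q) (K + 1 + i) ↔
      ReachesFrom (edges K m) y (hub 0) (K + 1 + i) := by
    intro q
    induction q using Fin.induction with
    | zero => rfl
    | succ p ih => rw [← hstep, ih]
  rw [h0] at h ⊢
  exact h

theorem reachesFrom_of_hub_zero (y : Node K m) (i : Fin K) (hy : ∀ l, y = sink l → i ≤ l) :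
    ReachesFrom (edges K m) y (hub 0) (K + 1 + i) := by
  cases y with
  | source j => exact .step (Arc.endSource j).mem_edges' (by omega) (.refl _)
  | relay j => exact .step (Arc.endRelay j).mem_edges' (by omega) (.refl _)
  | hub q => exact reachesFrom_of_hub (.refl _) 0
  | sink l =>
    have hil : (i : ℕ) ≤ l := hy l rfl
    exact (reachesFrom_of_hub (i := l)
      (.step (Arc.leave l).mem_edges' le_rfl (.refl _)) 0).antitone (by omega)

theorem reachesFrom_edges (hK : 0 < K) (x y : Node K m) : ReachesFrom (edges K m) y x 0 := by
  have h0 : ∀ q, ReachesFrom (edges K m) y (hub q) (K + 1) := fun q =>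
    reachesFrom_of_hub (i := ⟨0, hK⟩)
      (reachesFrom_of_hub_zero y ⟨0, hK⟩ fun l _ => Nat.zero_le _) q
  cases x with
  | hub q => exact (h0 q).antitone (by omega)
  | relay l => exact .step (Arc.startRelay l).mem_edges (by omega) ((h0 0).antitone (by omega))
  | sink l => exact .step (Arc.startSink l).mem_edges (by omega) ((h0 0).antitone (by omega))
  | source j =>
    by_cases hy : ∀ l, y = sink l → j ≤ l
    · exact .step (Arc.enter j).mem_edges (by omega) (reachesFrom_of_hub_zero y j hy)
    · push Not at hy
      obtain ⟨l, rfl, hlj⟩ := hy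
      exact .step (Arc.toRelay j l hlj).mem_edges (by omega)
        (.step (Arc.fromRelay l).mem_edges (by omega) (.refl _))

/-- A lower bound on the time at which source `i` arrives at a node if lane `i` is interrupted
between the hubs `p` and `p + 1`. -/
def arrival (i : Fin K) (p : Fin m) : Node K m → ℕ
  | source j => if j < i then 2 * K + 2 else if j = i then 0 else 2 + (j - i)
  | relay l => if l < i then 1 + (i - l) else if l = i then 2 * K + 2 else 2 * K + 1
  | sink l => if l < i then 2 * K + 1 else if l = i then 2 * K + 3 else K + 1 + l
  | hub q => if (q : ℕ) ≤ p then K + 1 + i else K + 2 + i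

/-- Every time edge of lane `i` between hubs is needed by source `i` to reach sink `i`. -/
theorem not_reachesFrom_edges_diff (i : Fin K) (p : Fin m) :
    ¬ ReachesFrom (edges K m \ {(s(hub p.castSucc, hub p.succ), K + 1 + (i : ℕ))})
      (sink i) (source i) 0 := by
  refine not_reachesFrom_of_arrival_bound (L := 2 * K + 2) (arrival i p)
    (fun e he => (Finset.mem_Icc.1 (label_mem_of_mem_edges he.1)).2) ?_ (by simp [arrival])
    (by simp [arrival])
  have key : ∀ (x y : Node K m) (l : ℕ), Arc x y l →
      (s(x, y), l) ≠ (s(hub p.castSucc, hub p.succ), K + 1 + (i : ℕ)) →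
      (arrival i p x ≤ l → arrival i p y ≤ l) ∧ (arrival i p y ≤ l → arrival i p x ≤ l) := by
    intro x y l h hne
    cases h with
    | lane j q =>
      have hjq : ¬ ((j : ℕ) = i ∧ (q : ℕ) = p) := by
        rintro ⟨hj, hq⟩
        obtain rfl := Fin.ext hj
        obtain rfl := Fin.ext hq
        exact hne rfl
      simp only [arrival, Fin.val_castSucc, Fin.val_succ]
      split_ifs <;> omega
    | toRelay j l h =>
      have := Fin.lt_def.1 h
      simp only [arrival, Fin.lt_def, Fin.ext_iff]
      split_ifs <;> omega
    | _ =>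
      simp only [arrival, Fin.lt_def, Fin.ext_iff, Fin.val_zero, Fin.val_last,
        Nat.zero_le, if_true]
      split_ifs <;> omega
  rintro x y l ⟨⟨x', y', h, hxy⟩, hne⟩
  rcases Sym2.eq_iff.1 hxy with ⟨rfl, rfl⟩ | ⟨rfl, rfl⟩
  · exact (key _ _ _ h hne).1
  · exact (key _ _ _ h fun heq => hne (by rw [Set.mem_singleton_iff, Sym2.eq_swap, heq])).2

end Node

theorem ReachesFrom.map {V W : Type*} {E : Set (TimeEdge V)} {F : Set (TimeEdge W)} {t v : V}
    {τ : ℕ} (h : ReachesFrom E t v τ) (f : V → W) (hf : ∀ e ∈ E, (e.1.map f, e.2) ∈ F) :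
    ReachesFrom F (f t) (f v) τ := by
  induction h with
  | refl => exact .refl _
  | step he hl _ ih => exact .step (by simpa using hf _ he) hl ih

/-- The host graph in which every edge carries all labels `1, …, L`. -/
def fullHost {V : Type*} [Fintype V] [DecidableEq V] (T : Finset V) (L : ℕ) (hL : 1 ≤ L) :
    HostGraph V where
  timeEdges := (Finset.univ.filter fun e : Sym2 V => ¬ e.IsDiag) ×ˢ Finset.Icc 1 L
  not_isDiag e he := (Finset.mem_filter.1 (Finset.mem_product.1 he).1).2
  label_pos e he := (Finset.mem_Icc.1 (Finset.mem_product.1 he).2).1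
  terminals := T
  complete e he := ⟨1, by simp [he, hL]⟩
  labels_contiguous e he l h1 hl := ⟨e.1, by
    simp only [Finset.mem_product, Finset.mem_Icc] at he ⊢
    exact ⟨he.1, h1, hl.trans he.2.2⟩⟩

section FullHost

variable {V : Type*} [Fintype V] [DecidableEq V]

/-- In a full host graph a star with label `1` is a solution. -/
theorem socialCost_le_of_isSocialOptimum_fullHost {C : ℝ} {T : Finset V} {L : ℕ} {hL : 1 ≤ L}
    {o : (fullHost T L hL).Profile} (ho : (fullHost T L hL).IsSocialOptimum C o) (c : V) :
    (fullHost T L hL).socialCost C o ≤ (Fintype.card V - 1 : ℕ) := by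
  let S : Finset (TimeEdge V) := (Finset.univ.erase c).image fun v => (s(v, c), 1)
  have hS : S ⊆ (fullHost T L hL).timeEdges := by
    intro e he
    obtain ⟨v, hv, rfl⟩ := Finset.mem_image.1 he
    simpa [fullHost, hL] using hv
  have hScard : S.card ≤ Fintype.card V - 1 :=
    Finset.card_image_le.trans (by rw [Finset.card_erase_of_mem (Finset.mem_univ c),
      Finset.card_univ])
  let p : (fullHost T L hL).Profile := fun v =>
    if v = c then ⟨S, hS⟩ else ⟨∅, Finset.empty_subset _⟩
  have hmem : ∀ v, v ≠ c →
      (s(v, c), 1) ∈ (((fullHost T L hL).formedGraph p).timeEdges : Set (TimeEdge V)) := by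
    intro v hv
    rw [Finset.mem_coe, HostGraph.mem_formedGraph]
    refine ⟨c, ?_⟩
    simp only [p, if_true]
    exact Finset.mem_image.2 ⟨v, by simp [hv], rfl⟩
  have hreach : ReachesAll (fullHost T L hL).terminals
      (((fullHost T L hL).formedGraph p).timeEdges : Set (TimeEdge V)) := by
    intro v t _
    have hc : ReachesFrom (((fullHost T L hL).formedGraph p).timeEdges : Set (TimeEdge V)) t c 1 := by
      by_cases htc : t = c
      · rw [htc]; exact .refl _
      · exact .step (by rw [Sym2.eq_swap]; exact hmem t htc) le_rfl (.refl _)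
    by_cases hvc : v = c
    · rw [hvc]; exact hc.antitone (by omega)
    · exact .step (hmem v hvc) (by omega) hc
  refine (ho p).trans ?_
  rw [HostGraph.socialCost_of_reachesAll _ hreach]
  refine Nat.cast_le.2 (le_trans (le_of_eq ?_) hScard)
  rw [Finset.sum_eq_single c (fun v _ hv => by simp [p, hv]) (by simp)]
  simp [p]

/-- If the terminals include the sinks, then the dense graph contains an equilibrium with all `K * m`
time edges between hubs. -/
theorem exists_isGreedyEquilibrium_fullHost {C : ℝ} (hC : 1 < C) {K m : ℕ} (hK : 0 < K)
    (φ : V ≃ Node K m) (T : Finset V) (hT : ∀ i, φ.symm (.sink i) ∈ T) :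
    ∃ s : (fullHost T (2 * K + 2) (by omega)).Profile,
      (fullHost T (2 * K + 2) (by omega)).IsGreedyEquilibrium C s ∧
      ((K * m : ℕ) : ℝ) ≤ (fullHost T (2 * K + 2) (by omega)).socialCost C s := by
  classical
  set H := fullHost T (2 * K + 2) (by omega) with hH
  let E : Finset (TimeEdge V) :=
    H.timeEdges.filter fun e => (e.1.map φ, e.2) ∈ Node.edges K m
  have hE : ∀ e ∈ Node.edges K m, (e.1.map φ.symm, e.2) ∈ (E : Set (TimeEdge V)) := by
    intro e he
    have hmap : Sym2.map φ (Sym2.map φ.symm e.1) = e.1 := by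
      rw [Sym2.map_map]; simp
    have hdiag : ¬ (Sym2.map φ.symm e.1).IsDiag := by
      have := Node.not_isDiag_of_mem_edges he
      obtain ⟨e, l⟩ := e
      induction e with
      | h x y => simpa using this
    rw [Finset.mem_coe, Finset.mem_filter]
    refine ⟨?_, by simpa only [hmap] using he⟩
    exact Finset.mem_product.2 ⟨by simpa using hdiag, Node.label_mem_of_mem_edges he⟩
  have hreach : ReachesAll H.terminals (E : Set (TimeEdge V)) := by
    intro v t _
    simpa using (Node.reachesFrom_edges hK (φ v) (φ t)).map φ.symm hE
  let lane : Fin K × Fin m → TimeEdge V := fun ip =>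
    (s(φ.symm (.hub ip.2.castSucc), φ.symm (.hub ip.2.succ)), K + 1 + ip.1)
  have hlane : Function.Injective lane := by
    rintro ⟨i, p⟩ ⟨j, q⟩ h
    simp only [lane, Prod.mk.injEq, Sym2.eq_iff, EmbeddingLike.apply_eq_iff_eq, Node.hub.injEq,
      Fin.ext_iff, Fin.val_castSucc, Fin.val_succ] at h ⊢
    omega
  obtain ⟨s, hs, hcost⟩ := HostGraph.exists_isGreedyEquilibrium_card_le (H := H) hC
    (D := Finset.univ.image lane) (Finset.filter_subset _ _) hreach (by
      intro e he hall
      obtain ⟨⟨i, p⟩, -, rfl⟩ := Finset.mem_image.1 he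
      refine Node.not_reachesFrom_edges_diff i p ?_
      have := (hall (φ.symm (.source i)) (φ.symm (.sink i)) (hT i)).map φ
        (F := Node.edges K m \ {(s(.hub p.castSucc, .hub p.succ), K + 1 + (i : ℕ))}) ?_
      · simpa using this
      · rintro e ⟨he, hne⟩
        refine ⟨(Finset.mem_filter.1 he).2, fun heq => hne ?_⟩
        rw [Set.mem_singleton_iff, Prod.ext_iff] at heq ⊢
        refine ⟨?_, heq.2⟩
        have := congrArg (Sym2.map φ.symm) heq.1
        rw [Sym2.map_map] at this
        simpa using this)
  refine ⟨s, hs, le_trans (le_of_eq ?_) hcost⟩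
  rw [Finset.card_image_of_injective _ hlane]
  simp

end FullHost

/-! ### The price of anarchy -/

section Ratios

variable {C : ℝ} {n k : ℕ}

theorem exists_nat_of_mem_greedyRatios (hC : 1 < C) (hn : 2 ≤ n) (hk : 1 ≤ k) {r : ℝ}
    (hr : r ∈ greedyRatios C n k) :
    ∃ M N : ℕ, r = (M : ℝ) / N ∧ n - 1 ≤ N ∧ N ≤ M ∧ M ≤ k * (n - 1) := by
  obtain ⟨H, hT, s, hs, o, ho, rfl⟩ := hr
  have h₁ := H.socialCost_of_reachesAll (C := C) (hs.reachesAll hC)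
  have h₂ := H.socialCost_of_reachesAll (C := C) (ho.reachesAll hC)
  refine ⟨∑ v, (s v).1.card, ∑ v, (o v).1.card, by rw [h₁, h₂], ?_, ?_, ?_⟩
  · have := HostGraph.card_le_sum_card_add_one (Finset.card_pos.1 (by omega)) (ho.reachesAll hC)
    rw [Fintype.card_fin] at this
    omega
  · have := ho s
    rw [h₁, h₂] at this
    exact_mod_cast this
  · have := hs.sum_card_le hC
    rwa [hT, Fintype.card_fin] at this

theorem finite_greedyRatios (hC : 1 < C) (hn : 2 ≤ n) (hk : 1 ≤ k) :
    (greedyRatios C n k).Finite := by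
  let B := Finset.range (k * (n - 1) + 1)
  refine ((B ×ˢ B).image fun p : ℕ × ℕ => (p.1 : ℝ) / p.2).finite_toSet.subset fun r hr => ?_
  obtain ⟨M, N, rfl, -, hNM, hM⟩ := exists_nat_of_mem_greedyRatios hC hn hk hr
  rw [Finset.mem_coe, Finset.mem_image]
  exact ⟨(M, N), by simp only [B, Finset.mem_product, Finset.mem_range]; omega, rfl⟩

theorem le_of_mem_greedyRatios (hC : 1 < C) (hn : 2 ≤ n) (hk : 1 ≤ k) {r : ℝ}
    (hr : r ∈ greedyRatios C n k) : r ≤ k := by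
  obtain ⟨M, N, rfl, hN, -, hM⟩ := exists_nat_of_mem_greedyRatios hC hn hk hr
  rw [div_le_iff₀ (by exact_mod_cast (by omega : 0 < N))]
  exact_mod_cast hM.trans (Nat.mul_le_mul_left k hN)

theorem one_le_of_mem_greedyRatios (hC : 1 < C) (hn : 2 ≤ n) (hk : 1 ≤ k) {r : ℝ}
    (hr : r ∈ greedyRatios C n k) : 1 ≤ r := by
  obtain ⟨M, N, rfl, hN, hNM, -⟩ := exists_nat_of_mem_greedyRatios hC hn hk hr
  rw [one_le_div (by exact_mod_cast (by omega : 0 < N))]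
  exact_mod_cast hNM

theorem nonempty_greedyRatios (hC : 1 < C) (hkn : k ≤ n) : (greedyRatios C n k).Nonempty := by
  obtain ⟨T, -, hT⟩ := Finset.exists_subset_card_eq (s := (Finset.univ : Finset (Fin n)))
    (n := k) (by simpa using hkn)
  let H := fullHost T 1 le_rfl
  obtain ⟨s, hs, -⟩ := HostGraph.exists_isGreedyEquilibrium_card_le (H := H) (D := ∅) hC
    subset_rfl (H.reachesAll_timeEdges _) (by simp)
  obtain ⟨o, ho⟩ := H.exists_isSocialOptimum C
  exact ⟨_, H, hT, s, hs, o, ho, rfl⟩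

/-- For large `k`, the dense graph with `K = k / 6` lanes: as `3 * K ≤ n / 2`, at least half of the
nodes are hubs, whereas an optimum consists of `n - 1` time edges. -/
theorem exists_mem_greedyRatios (hC : 1 < C) (hk : 12 ≤ k) (hkn : k ≤ n) :
    ∃ r ∈ greedyRatios C n k, (1 / 36 : ℝ) * k ≤ r := by
  obtain ⟨K, hK⟩ : ∃ K, K = k / 6 := ⟨_, rfl⟩
  obtain ⟨m, hm⟩ : ∃ m, n = 3 * K + m + 1 := ⟨n - (3 * K + 1), by omega⟩
  have hcard : Fintype.card ((Fin K ⊕ Fin K) ⊕ (Fin K ⊕ Fin (m + 1))) = n := by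
    simp only [Fintype.card_sum, Fintype.card_fin]
    omega
  let φ : Fin n ≃ Node K m := (Node.equivSum.trans (Fintype.equivFinOfCardEq hcard)).symm
  let sinks : Finset (Fin n) := Finset.univ.image fun i => φ.symm (.sink i)
  have hsinks : sinks.card ≤ k := Finset.card_image_le.trans (by simp; omega)
  obtain ⟨T, hsT, -, hT⟩ := Finset.exists_subsuperset_card_eq (Finset.subset_univ sinks) hsinks
    (by simpa using hkn)
  obtain ⟨s, hs, hcost⟩ := exists_isGreedyEquilibrium_fullHost hC (by omega : 0 < K) φ T
    fun i => hsT (Finset.mem_image_of_mem _ (Finset.mem_univ i))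
  obtain ⟨o, ho⟩ := (fullHost T (2 * K + 2) (by omega)).exists_isSocialOptimum C
  have hle := socialCost_le_of_isSocialOptimum_fullHost ho ⟨0, by omega⟩
  rw [Fintype.card_fin] at hle
  have hmem : _ ∈ greedyRatios C n k := ⟨_, hT, s, hs, o, ho, rfl⟩
  refine ⟨_, hmem, ?_⟩
  have hpos : 0 < (fullHost T (2 * K + 2) (by omega)).socialCost C o := by
    have hreach := ho.reachesAll hC
    have := HostGraph.card_le_sum_card_add_one (Finset.card_pos.1 (by
      rw [show (fullHost T (2 * K + 2) (by omega)).terminals = T from rfl]; omega)) hreach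
    rw [Fintype.card_fin] at this
    rw [HostGraph.socialCost_of_reachesAll _ hreach]
    exact_mod_cast (by omega : 0 < ∑ v, (o v).1.card)
  rw [le_div_iff₀ hpos]
  have h₁ : (k : ℝ) ≤ 12 * K := by exact_mod_cast (by omega : k ≤ 12 * K)
  have h₂ : ((n - 1 : ℕ) : ℝ) ≤ 3 * m := by exact_mod_cast (by omega : n - 1 ≤ 3 * m)
  calc (1 / 36 : ℝ) * k * (fullHost T (2 * K + 2) (by omega)).socialCost C o
      ≤ (1 / 36 : ℝ) * (12 * K) * (3 * m) := by
        have := hle.trans h₂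
        gcongr
    _ = ((K * m : ℕ) : ℝ) := by push_cast; ring
    _ ≤ _ := hcost

end Ratios

end TNCG

/-- The Price of Anarchy for Greedy Equilibria in the global edge-buying `k`-terminal game is a
genuine maximum and is `Θ(k)`; the constants depend neither on `n` and `k` nor on the cost
parameter `C`. -/
theorem mainTheorem10 :
    ∃ c : ℝ, 0 < c ∧ ∀ (C : ℝ), 1 < C → ∀ n k : ℕ, 2 ≤ n → 1 ≤ k → k ≤ n →
      IsGreatest (TNCG.greedyRatios C n k) (TNCG.greedyPoA C n k) ∧
      c * (k : ℝ) ≤ TNCG.greedyPoA C n k ∧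
      TNCG.greedyPoA C n k ≤ (k : ℝ) := by
  refine ⟨1 / 36, by norm_num, fun C hC n k hn hk hkn => ?_⟩
  have hmax : IsGreatest (TNCG.greedyRatios C n k) (TNCG.greedyPoA C n k) :=
    ⟨(TNCG.nonempty_greedyRatios hC hkn).csSup_mem (TNCG.finite_greedyRatios hC hn hk),
      fun _ hr => le_csSup (TNCG.finite_greedyRatios hC hn hk).bddAbove hr⟩
  refine ⟨hmax, ?_, TNCG.le_of_mem_greedyRatios hC hn hk hmax.1⟩
  by_cases h : 12 ≤ k
  · obtain ⟨r, hr, hle⟩ := TNCG.exists_mem_greedyRatios hC h hkn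
    exact hle.trans (hmax.2 hr)
  · have h₁ := TNCG.one_le_of_mem_greedyRatios hC hn hk hmax.1
    have h₂ : (k : ℝ) ≤ 12 := by exact_mod_cast (by omega : k ≤ 12)
    linarith
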